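/- For a topological space $X$, let $\mathscr{F}(X)$ be the set of all nonempty closed subsets of $X$, equipped with the Vietoris topology, i.e. the topology generated by the sets $\langle U_1,\dots,U_n\rangle=\{S\in\mathscr{F}(X): S\subset U_1\cup\dots\cup U_n\text{ and }S\cap U_i\neq\emptyset\text{ for all }i\le n\}$ with $U_1,\dots,U_n\subset X$ open. A continuous selection for $\mathscr{F}(X)$ is a continuous map $f:\mathscr{F}(X)\to X$ with $f(S)\in S$ for every $S\in\mathscr{F}(X)$. For $p\in X$, such an $f$ is called $p$-maximal if $f(S)=p$ for every $S\in\mathscr{F}(X)$ with $p\in S$, and $p$-minimal if $f(S)\neq p$ for every $S\in\mathscr{F}(X)$ with $S\neq\{p\}$. The space $X$ is selection pointwise-maximal (respectively, selection pointwise-minimal) if for every $p\in X$ there exists a $p$-maximal (respectively, $p$-minimal) continuous selection for $\mathscr{F}(X)$. Theorem. Every Hausdorff selection pointwise-maximal space is selection pointwise-minimal. -/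

import Mathlib

universe u

namespace HyperspaceSelection

/-- The hyperspace `𝓕(X)` of all nonempty closed subsets of `X`. -/
@[ext]
structure Hyperspace (X : Type u) [TopologicalSpace X] : Type u where
  /-- The underlying set. -/
  carrier : Set X
  isClosed : IsClosed carrier
  nonempty : carrier.Nonempty

/-- The Vietoris topology on `𝓕(X)`: the topology with subbase `{S | S ⊆ U}`, `{S | S ∩ U ≠ ∅}`,
`U` open in `X`; equivalently, with base the sets `⟨U₁, …, Uₙ⟩`, `Uᵢ` open in `X`. -/
instance (X : Type u) [TopologicalSpace X] : TopologicalSpace (Hyperspace X) :=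
  TopologicalSpace.induced Hyperspace.carrier (TopologicalSpace.vietoris X)

/-- `sel[𝓕(X)]`: the set of all Vietoris continuous selections for `𝓕(X)`. -/
def Sel (X : Type u) [TopologicalSpace X] : Set (Hyperspace X → X) :=
  {f | (∀ S : Hyperspace X, f S ∈ S.carrier) ∧ Continuous f}

/-- A continuous selection `f` for `𝓕(X)` is `p`-maximal if `f(S) = p` whenever `p ∈ S`. -/
def IsMaximalAt {X : Type u} [TopologicalSpace X] (f : Hyperspace X → X) (p : X) : Prop :=
  f ∈ Sel X ∧ ∀ S : Hyperspace X, p ∈ S.carrier → f S = p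

/-- A continuous selection `f` for `𝓕(X)` is `p`-minimal if `f(S) ≠ p` whenever `S ≠ {p}`. -/
def IsMinimalAt {X : Type u} [TopologicalSpace X] (f : Hyperspace X → X) (p : X) : Prop :=
  f ∈ Sel X ∧ ∀ S : Hyperspace X, S.carrier ≠ {p} → f S ≠ p

/-- Every point of `X` is selection-maximal. -/
def SelectionPointwiseMaximal (X : Type u) [TopologicalSpace X] : Prop :=
  ∀ p : X, ∃ f : Hyperspace X → X, IsMaximalAt f p

/-- Every point of `X` is selection-minimal. -/
def SelectionPointwiseMinimal (X : Type u) [TopologicalSpace X] : Prop :=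
  ∀ p : X, ∃ f : Hyperspace X → X, IsMinimalAt f p

end HyperspaceSelection

/-! Read `f {a, b} = b` as "b lies f-below a"; this relation need not be transitive, but the points
strictly below (or above) a given one form an open set. An isolated `p` is simply deleted from every
closed set other than `{p}`. Otherwise a `p`-maximal `f` yields a continuous, strictly f-decreasing
transfinite sequence `x α` ending at `x lam = p`, with `lam` a limit (`exists_isTower`). The closed
sets `outer α` of points above the tail from `α` on increase and exhaust the complement of `p` as `α
< lam` grows. Since X is zero-dimensional (`exists_isClopen_subset`), a clopen `E α` fits between
`outer α` and `outer (succ α)`.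

For `S ≠ {p}` let α be least such that S meets `E α`, and put `g S = sel α (S ∩ E α)` with `sel α`
an `x α`-maximal selection. As `p ∉ E α`, g is `p`-minimal. Continuity is delicate only at a limit α
with `x α ∈ S`: nearby T may meet earlier layers, but the part of T in `outer α` is close to `x α`,
which is `g S` by maximality. -/

namespace HyperspaceSelection

open Set Filter Topology

/-! ### Vietoris convergence and clopen traces -/

section

variable {X : Type u} [TopologicalSpace X]

theorem tendsto_hyperspace_iff {Y : Type*} {l : Filter Y} {F : Y → Hyperspace X}
    {S : Hyperspace X} :
    Tendsto F l (𝓝 S) ↔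
      (∀ U, IsOpen U → S.carrier ⊆ U → ∀ᶠ y in l, (F y).carrier ⊆ U) ∧
      ∀ V, IsOpen V → (S.carrier ∩ V).Nonempty → ∀ᶠ y in l, ((F y).carrier ∩ V).Nonempty := by
  let _ : TopologicalSpace (Set X) := TopologicalSpace.vietoris X
  rw [nhds_induced, tendsto_comap_iff]
  refine TopologicalSpace.tendsto_nhds_generateFrom_iff.trans ⟨fun h => ⟨?_, ?_⟩, ?_⟩
  · intro U hU hS
    exact h _ (Or.inl ⟨U, hU, rfl⟩) hS
  · intro V hV hS
    exact h _ (Or.inr ⟨V, hV, rfl⟩) hS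
  · rintro ⟨h₁, h₂⟩ _ (⟨U, hU, rfl⟩ | ⟨V, hV, rfl⟩) hS
    · exact h₁ U hU hS
    · exact h₂ V hV hS

theorem eventually_subset {S : Hyperspace X} {U : Set X} (hU : IsOpen U) (h : S.carrier ⊆ U) :
    ∀ᶠ T : Hyperspace X in 𝓝 S, T.carrier ⊆ U :=
  (tendsto_hyperspace_iff.1 (tendsto_id (x := 𝓝 S))).1 U hU h

theorem eventually_meets {S : Hyperspace X} {V : Set X} (hV : IsOpen V)
    (h : (S.carrier ∩ V).Nonempty) :
    ∀ᶠ T : Hyperspace X in 𝓝 S, (T.carrier ∩ V).Nonempty :=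
  (tendsto_hyperspace_iff.1 (tendsto_id (x := 𝓝 S))).2 V hV h

/-- The closure of a nonempty set as a point of the hyperspace. -/
def hull (A : Set X) (hA : A.Nonempty) : Hyperspace X :=
  ⟨closure A, isClosed_closure, hA.closure⟩

theorem hull_congr {A B : Set X} (h : A = B) (hA : A.Nonempty) :
    hull A hA = hull B (h ▸ hA) := by
  subst h; rfl

/-- A closed set `S` cut down to a closed set `E` which it meets. -/
noncomputable def trace (E : Set X) (hE : IsClosed E) (S : Hyperspace X) : Hyperspace X :=
  open Classical in
  if h : (S.carrier ∩ E).Nonempty then ⟨S.carrier ∩ E, S.isClosed.inter hE, h⟩ else S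

theorem trace_carrier {E : Set X} (hE : IsClosed E) {S : Hyperspace X}
    (h : (S.carrier ∩ E).Nonempty) : (trace E hE S).carrier = S.carrier ∩ E := by
  simp [trace, h]

theorem continuousAt_trace {E : Set X} (hE : IsClopen E) {S : Hyperspace X}
    (h : (S.carrier ∩ E).Nonempty) : ContinuousAt (trace E hE.1) S := by
  have hm := eventually_meets hE.2 h
  rw [ContinuousAt, tendsto_hyperspace_iff, trace_carrier hE.1 h]
  constructor
  · intro U hU hS
    have hsub : S.carrier ⊆ U ∪ Eᶜ := fun x hx => by
      by_cases hxE : x ∈ E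
      · exact Or.inl (hS ⟨hx, hxE⟩)
      · exact Or.inr hxE
    filter_upwards [hm, eventually_subset (hU.union hE.1.isOpen_compl) hsub] with T hT hTU
    rw [trace_carrier hE.1 hT]
    rintro x ⟨hx, hxE⟩
    exact (hTU hx).resolve_right fun h => h hxE
  · intro V hV hS
    rw [inter_assoc] at hS
    filter_upwards [hm, eventually_meets (hE.2.inter hV) hS] with T hT hTV
    rwa [trace_carrier hE.1 hT, inter_assoc]

/-- `t` splits its complement into two disjoint open sets, with `z` in the first and `p` in the
second. -/
def Splits (t z p : X) : Prop :=
  ∃ A B : Set X, IsOpen A ∧ IsOpen B ∧ Disjoint A B ∧ A ∪ B = {t}ᶜ ∧ z ∈ A ∧ p ∈ B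

theorem Splits.symm {t z p : X} (h : Splits t z p) : Splits t p z := by
  obtain ⟨A, B, hA, hB, hd, hu, hz, hp⟩ := h
  exact ⟨B, A, hB, hA, hd.symm, by rwa [union_comm], hp, hz⟩

/-- If both `t` and `z` separate the other one from `p`, then a clopen set separates them
from `p`. -/
theorem exists_isClopen_of_splits {t z p : X} (h₁ : Splits t z p) (h₂ : Splits z t p) :
    ∃ G : Set X, IsClopen G ∧ t ∈ G ∧ z ∈ G ∧ p ∉ G := by
  obtain ⟨A, B, hA, hB, hd, hu, hz, hp⟩ := h₁
  obtain ⟨A', B', hA', hB', hd', hu', ht', hp'⟩ := h₂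
  refine ⟨A ∪ A', ⟨?_, hA.union hA'⟩, Or.inr ht', Or.inl hz, ?_⟩
  · have : A ∪ A' = (B ∩ B')ᶜ := by
      ext y
      have e₁ : (y ∈ A ∨ y ∈ B) ↔ y ≠ t := Set.ext_iff.1 hu y
      have e₂ : (y ∈ A' ∨ y ∈ B') ↔ y ≠ z := Set.ext_iff.1 hu' y
      have d₁ : y ∈ A → y ∉ B := fun h => disjoint_left.1 hd h
      have d₂ : y ∈ A' → y ∉ B' := fun h => disjoint_left.1 hd' h
      have s₁ : y = t → y ∈ A' := fun h => h ▸ ht'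
      have s₂ : y = z → y ∈ A := fun h => h ▸ hz
      simp only [mem_union, mem_compl_iff, mem_inter_iff]
      tauto
    rw [this]
    exact (hB.inter hB').isClosed_compl
  · rintro (h | h)
    · exact disjoint_left.1 hd h hp
    · exact disjoint_left.1 hd' h hp'

section T1

variable [T1Space X]

/-- The closed set `{a, b}`. -/
def pair (a b : X) : Hyperspace X :=
  ⟨{a, b}, (Set.toFinite _).isClosed, insert_nonempty _ _⟩

theorem pair_comm (a b : X) : pair a b = pair b a :=
  Hyperspace.ext (Set.pair_comm a b)

theorem continuous_pair : Continuous fun z : X × X => pair z.1 z.2 := by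
  refine continuous_iff_continuousAt.2 fun z => tendsto_hyperspace_iff.2 ⟨?_, ?_⟩
  · intro U hU h
    have h₁ : z.1 ∈ U := h (by simp [pair])
    have h₂ : z.2 ∈ U := h (by simp [pair])
    filter_upwards [continuousAt_fst.eventually_mem (hU.mem_nhds h₁),
      continuousAt_snd.eventually_mem (hU.mem_nhds h₂)] with w hw₁ hw₂
    exact insert_subset hw₁ (singleton_subset_iff.2 hw₂)
  · rintro V hV ⟨x, rfl | rfl, hx⟩
    · filter_upwards [continuousAt_fst.eventually_mem (hV.mem_nhds hx)] with w hw
      exact ⟨w.1, by simp [pair], hw⟩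
    · filter_upwards [continuousAt_snd.eventually_mem (hV.mem_nhds hx)] with w hw
      exact ⟨w.2, by simp [pair], hw⟩

theorem closure_insert_eq (y : X) (A : Set X) : closure (insert y A) = insert y (closure A) := by
  rw [insert_eq, closure_union, closure_singleton, ← insert_eq]

theorem continuous_hull_insert (A : Set X) :
    Continuous fun y => hull (insert y A) (insert_nonempty y A) := by
  refine continuous_iff_continuousAt.2 fun y => tendsto_hyperspace_iff.2 ⟨?_, ?_⟩
  · intro U hU h
    simp only [hull, closure_insert_eq, insert_subset_iff] at h ⊢
    filter_upwards [hU.mem_nhds h.1] with w hw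
    exact ⟨hw, h.2⟩
  · intro V hV h
    simp only [hull, closure_insert_eq] at h ⊢
    obtain ⟨x, rfl | hx, hxV⟩ := h
    · filter_upwards [hV.mem_nhds hxV] with w hw
      exact ⟨w, by simp, hw⟩
    · exact Eventually.of_forall fun w => ⟨x, Or.inr hx, hxV⟩

end T1

/-! ### The relation defined by a selection, and zero-dimensionality -/

section Sel

variable [T2Space X] {f : Hyperspace X → X}

theorem Sel.pair_eq_or (hf : f ∈ Sel X) (a b : X) : f (pair a b) = a ∨ f (pair a b) = b := by
  have := hf.1 (pair a b)
  simpa [pair] using this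

theorem Sel.continuous_pair (hf : f ∈ Sel X) : Continuous fun z : X × X => f (pair z.1 z.2) :=
  hf.2.comp HyperspaceSelection.continuous_pair

/-- If `f {a, b} = a ≠ b`, then this persists near `(a, b)`. -/
theorem Sel.eventually_pair_eq_fst (hf : f ∈ Sel X) {a b : X} (h : f (pair a b) = a)
    (hab : a ≠ b) :
    ∀ᶠ z : X × X in 𝓝 (a, b), f (pair z.1 z.2) = z.1 ∧ z.1 ≠ z.2 := by
  obtain ⟨U, V, hU, hV, haU, hbV, hUV⟩ := t2_separation hab
  have h₁ : ∀ᶠ z : X × X in 𝓝 (a, b), f (pair z.1 z.2) ∈ U :=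
    (Sel.continuous_pair hf).continuousAt.eventually_mem (hU.mem_nhds (by simpa [h] using haU))
  have h₂ : ∀ᶠ z : X × X in 𝓝 (a, b), z.1 ∈ U :=
    continuousAt_fst.eventually_mem (hU.mem_nhds haU)
  have h₃ : ∀ᶠ z : X × X in 𝓝 (a, b), z.2 ∈ V :=
    continuousAt_snd.eventually_mem (hV.mem_nhds hbV)
  filter_upwards [h₁, h₂, h₃] with z hz₁ hz₂ hz₃
  refine ⟨(Sel.pair_eq_or hf _ _).resolve_right fun hz => ?_, fun hz => ?_⟩
  · exact disjoint_left.1 hUV hz₁ (by rwa [hz])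
  · exact disjoint_left.1 hUV hz₂ (by rwa [hz])

theorem Sel.eventually_pair_eq_snd (hf : f ∈ Sel X) {a b : X} (h : f (pair a b) = b)
    (hab : a ≠ b) :
    ∀ᶠ z : X × X in 𝓝 (a, b), f (pair z.1 z.2) = z.2 ∧ z.1 ≠ z.2 := by
  have := Sel.eventually_pair_eq_fst hf (a := b) (b := a) (by rwa [HyperspaceSelection.pair_comm])
    hab.symm
  have hs : Tendsto Prod.swap (𝓝 (a, b)) (𝓝 (b, a)) := continuous_swap.tendsto (a, b)
  filter_upwards [hs.eventually this] with z hz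
  rw [HyperspaceSelection.pair_comm]
  exact ⟨hz.1, hz.2.symm⟩

/-- The points strictly `f`-below `t`. -/
def below (f : Hyperspace X → X) (t : X) : Set X := {y | f (pair t y) = y ∧ t ≠ y}

/-- The points strictly `f`-above `t`. -/
def above (f : Hyperspace X → X) (t : X) : Set X := {y | f (pair t y) = t ∧ t ≠ y}

theorem isOpen_below (hf : f ∈ Sel X) (t : X) : IsOpen (below f t) :=
  isOpen_iff_mem_nhds.2 fun _ hy =>
    (Continuous.prodMk_right t).continuousAt.eventually (Sel.eventually_pair_eq_snd hf hy.1 hy.2)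

theorem isOpen_above (hf : f ∈ Sel X) (t : X) : IsOpen (above f t) :=
  isOpen_iff_mem_nhds.2 fun _ hy =>
    (Continuous.prodMk_right t).continuousAt.eventually (Sel.eventually_pair_eq_fst hf hy.1 hy.2)

theorem mem_below_or_above (hf : f ∈ Sel X) {t y : X} (h : t ≠ y) :
    y ∈ below f t ∨ y ∈ above f t := by
  rcases Sel.pair_eq_or hf t y with h' | h'
  · exact Or.inr ⟨h', h⟩
  · exact Or.inl ⟨h', h⟩

theorem disjoint_below_above (t : X) : Disjoint (below f t) (above f t) :=
  disjoint_left.2 fun _ h₁ h₂ => h₁.2 (h₂.1.symm.trans h₁.1)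

theorem splits_of_pair (hf : f ∈ Sel X) {t z p : X} (htz : t ≠ z) (htp : t ≠ p)
    (hz : f (pair t z) = z) (hp : f (pair t p) = t) : Splits t z p := by
  refine ⟨below f t, above f t, isOpen_below hf t, isOpen_above hf t, disjoint_below_above t, ?_,
    ⟨hz, htz⟩, ⟨hp, htp⟩⟩
  ext y
  refine ⟨?_, fun hy => mem_below_or_above hf fun h => hy h.symm⟩
  rintro (h | h) rfl
  · exact h.2 rfl
  · exact h.2 rfl

/-- If some `z ≠ p` lies below `t`, a `z`-maximal selection compares `p` with `t`; then `z` and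
whichever of the two it selects each separate the other from the remaining point. If there is no
such `z`, then `{p}` itself is open. -/
theorem exists_isClopen_separating (hX : SelectionPointwiseMaximal X) {p t : X} (hpt : p ≠ t) :
    ∃ G : Set X, IsClopen G ∧ p ∈ G ∧ t ∉ G := by
  obtain ⟨f, hf, hfp⟩ := hX p
  by_cases hz : ∃ z, z ≠ p ∧ z ∈ below f t
  · obtain ⟨z, hzp, hzt, htz⟩ := hz
    have hfz : Splits z p t := by
      refine splits_of_pair hf hzp htz.symm (hfp _ (by simp [pair])) ?_
      rwa [pair_comm]
    obtain ⟨k, hk, hkz⟩ := hX z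
    rcases Sel.pair_eq_or hk p t with h | h
    · have hkp : Splits p z t :=
        splits_of_pair hk hzp.symm hpt (hkz _ (by simp [pair])) h
      obtain ⟨G, hG, h₁, -, h₂⟩ := exists_isClopen_of_splits hkp hfz
      exact ⟨G, hG, h₁, h₂⟩
    · have hkt : Splits t z p :=
        splits_of_pair hk htz hpt.symm (hkz _ (by simp [pair])) (by rwa [pair_comm])
      obtain ⟨G, hG, h₁, -, h₂⟩ := exists_isClopen_of_splits hkt hfz.symm
      exact ⟨Gᶜ, hG.compl, h₂, fun h => h h₁⟩
  · have : below f t = {p} := by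
      ext z
      refine ⟨fun h => by_contra fun hp => hz ⟨z, hp, h⟩, ?_⟩
      rintro rfl
      exact ⟨hfp _ (by simp [pair]), hpt.symm⟩
    exact ⟨{p}, ⟨isClosed_singleton, this ▸ isOpen_below hf t⟩, rfl, fun h => hpt h.symm⟩

/-- The map `F y = f ({y} ∪ Vᶜ)` fixes `p`, is constantly `t` on `Vᶜ`, and sends each `y` to itself
or into `Vᶜ`. Within a clopen set avoiding `t`, its closed fixed-point set is therefore the open set
`V ∩ F ⁻¹' V`. -/
theorem exists_isClopen_subset (hX : SelectionPointwiseMaximal X) {p : X} {V : Set X}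
    (hV : IsOpen V) (hp : p ∈ V) : ∃ G : Set X, IsClopen G ∧ p ∈ G ∧ G ⊆ V := by
  rcases Vᶜ.eq_empty_or_nonempty with hT | hT
  · exact ⟨univ, isClopen_univ, trivial, fun x _ => by_contra fun h => (hT ▸ h : x ∈ (∅ : Set X))⟩
  obtain ⟨f, hf, hfp⟩ := hX p
  set F : X → X := fun y => f (hull (insert y Vᶜ) (insert_nonempty _ _)) with hF
  have hFc : Continuous F := hf.2.comp (continuous_hull_insert _)
  have hFm : ∀ y, F y = y ∨ F y ∈ Vᶜ := fun y => by
    have : F y ∈ closure (insert y Vᶜ) := hf.1 (hull (insert y Vᶜ) (insert_nonempty _ _))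
    rwa [closure_insert_eq, hV.isClosed_compl.closure_eq] at this
  set t := f (hull Vᶜ hT)
  have htV : t ∈ Vᶜ := by
    have : t ∈ closure Vᶜ := hf.1 (hull Vᶜ hT)
    rwa [hV.isClosed_compl.closure_eq] at this
  have hFt : ∀ y ∈ Vᶜ, F y = t := fun y hy => by
    simp only [hF, t]
    rw [hull_congr (insert_eq_of_mem hy)]
  obtain ⟨G, hG, hpG, htG⟩ := exists_isClopen_separating hX (p := p) (t := t)
    fun h => htV (h ▸ hp)
  refine ⟨V ∩ F ⁻¹' V ∩ G, ⟨?_, (hV.inter (hV.preimage hFc)).inter hG.2⟩, ⟨⟨hp, ?_⟩, hpG⟩,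
    fun y hy => hy.1.1⟩
  · have : V ∩ F ⁻¹' V ∩ G = {y | F y = y} ∩ G := by
      ext y
      refine and_congr_left fun hyG => ⟨fun h => (hFm y).resolve_right fun h' => h' h.2, ?_⟩
      intro (h : F y = y)
      have hy : y ∈ V := by
        by_contra hy
        exact htG ((hFt y hy ▸ h) ▸ hyG)
      exact ⟨hy, by rwa [mem_preimage, h]⟩
    rw [this]
    exact (isClosed_eq hFc continuous_id).inter hG.1
  · have : F p = p := hfp _ (subset_closure (mem_insert _ _))
    rwa [mem_preimage, this]

theorem exists_isMinimalAt_of_isOpen_singleton (hf : f ∈ Sel X) {p : X}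
    (hp : IsOpen ({p} : Set X)) : ∃ g : Hyperspace X → X, IsMinimalAt g p := by
  classical
  have hE : IsClopen ({p}ᶜ : Set X) := IsClopen.compl ⟨isClosed_singleton, hp⟩
  have hne : ∀ S : Hyperspace X, (S.carrier ∩ {p}ᶜ).Nonempty ↔ S.carrier ≠ {p} := fun S => by
    rw [inter_compl_nonempty_iff, not_iff_not]
    exact S.nonempty.subset_singleton_iff
  refine ⟨fun S => f (trace {p}ᶜ hE.1 S), ⟨fun S => ?_, ?_⟩, fun S hS => ?_⟩
  · by_cases h : (S.carrier ∩ {p}ᶜ).Nonempty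
    · have := hf.1 (trace {p}ᶜ hE.1 S)
      rw [trace_carrier _ h] at this
      exact this.1
    -- Here `S = {p}`, and the default value of `trace` is the right one.
    · have : trace {p}ᶜ hE.1 S = S := by rw [trace, dif_neg h]
      simpa only [this] using hf.1 S
  · refine continuous_iff_continuousAt.2 fun S => ?_
    by_cases h : (S.carrier ∩ {p}ᶜ).Nonempty
    · exact hf.2.continuousAt.comp (continuousAt_trace hE h)
    · have hS : S.carrier ⊆ {p} := by rwa [inter_compl_nonempty_iff, not_not] at h
      refine ContinuousAt.congr hf.2.continuousAt ?_
      filter_upwards [eventually_subset hp hS] with T hT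
      rw [trace, dif_neg]
      rwa [inter_compl_nonempty_iff, not_not]
  · have h := (hne S).2 hS
    have := hf.1 (trace {p}ᶜ hE.1 S)
    rw [trace_carrier _ h] at this
    exact this.2

end Sel

end

/-! ### Transfinite descent to `p` -/

section

variable {X : Type u}

theorem exists_transfinite_rec (G : Ordinal.{u} → Set X → X) :
    ∃ x : Ordinal.{u} → X, ∀ α, x α = G α (x '' Iio α) := by
  refine ⟨(wellFounded_lt (α := Ordinal.{u})).fix
    fun α ih => G α (range fun β : Iio α => ih β.1 β.2), fun α => ?_⟩
  rw [WellFounded.fix_eq, image_eq_range]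

variable [TopologicalSpace X] {f : Hyperspace X → X}

theorem neBot_nhdsLT_of_isSuccLimit {γ : Ordinal.{u}} (hγ : Order.IsSuccLimit γ) :
    (𝓝[<] γ).NeBot := by
  obtain ⟨a, ha⟩ := not_isMin_iff.1 hγ.not_isMin
  refine IsLUB.nhdsWithin_neBot (s := Iio γ) ?_ ⟨a, ha⟩
  refine ⟨fun _ h => le_of_lt h, fun b hb => le_of_not_gt fun hlt => ?_⟩
  exact (lt_irrefl _ ((Order.lt_succ b).trans_le (hb (hγ.succ_lt hlt))))

/-- `Iic γ = Iio (succ γ)` is a neighbourhood of `γ`, so only the left limit matters. -/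
theorem tendsto_nhds_of_tendsto_nhdsLT {x : Ordinal.{u} → X} {γ : Ordinal.{u}}
    (h : Tendsto x (𝓝[<] γ) (𝓝 (x γ))) : ContinuousAt x γ := by
  have h₁ : Tendsto x (𝓝[≤] γ) (𝓝 (x γ)) := by
    rw [← Iio_insert, nhdsWithin_insert, tendsto_sup]
    exact ⟨tendsto_pure_nhds x γ, h⟩
  rwa [← Order.Iio_succ, nhdsWithin_eq_nhds.2 (Iio_mem_nhds (Order.lt_succ γ))] at h₁

/-- Increasing initial segments converge to the closure of their union. -/
theorem tendsto_hull_image_Iic (x : Ordinal.{u} → X) {γ : Ordinal.{u}} (hne : (Iio γ).Nonempty) :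
    Tendsto (fun β => hull (x '' Iic β) (nonempty_Iic.image x)) (𝓝[<] γ)
      (𝓝 (hull (x '' Iio γ) (hne.image x))) := by
  refine tendsto_hyperspace_iff.2 ⟨?_, ?_⟩
  · intro U hU h
    filter_upwards [self_mem_nhdsWithin] with β hβ
    exact (closure_mono (image_mono (Iic_subset_Iio.2 hβ))).trans h
  · intro V hV h
    obtain ⟨_, ⟨δ, hδ, rfl⟩, hV'⟩ := (closure_inter_open_nonempty_iff hV).1 h
    filter_upwards [Ioo_mem_nhdsLT hδ] with β hβ
    exact ⟨x δ, subset_closure ⟨δ, hβ.1.le, rfl⟩, hV'⟩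

variable [T2Space X]

/-- A continuous well-ordered `f`-decreasing family of points, indexed by the ordinals up to the
limit ordinal `lam`. -/
structure IsTower (f : Hyperspace X → X) (x : Ordinal.{u} → X) (lam : Ordinal.{u}) : Prop where
  isSuccLimit : Order.IsSuccLimit lam
  continuousAt : ∀ γ ≤ lam, ContinuousAt x γ
  pair_eq : ∀ β γ, β < γ → γ ≤ lam → f (pair (x β) (x γ)) = x γ ∧ x β ≠ x γ

/-- `y` is selected from `A ∪ {y}` and lies strictly `f`-below all of `A`. -/
def IsNext (f : Hyperspace X → X) (A : Set X) (y : X) : Prop :=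
  f (hull (insert y A) (insert_nonempty y A)) = y ∧ ∀ z ∈ A, f (pair z y) = y ∧ z ≠ y

/-- Maximality gives both conditions at `y = p`, and they persist near `p`, uniformly in `z ∈ A` by
compactness. Non-isolation supplies `y ≠ p`. -/
theorem exists_isNext {p : X} (hf : IsMaximalAt f p) (hp : ¬ IsOpen ({p} : Set X)) {A : Set X}
    (hA : IsCompact A) (hpA : p ∉ A) : ∃ y, y ≠ p ∧ IsNext f A y := by
  obtain ⟨hf, hfp⟩ := hf
  have h₁ : ∀ᶠ y in 𝓝 p, f (hull (insert y A) (insert_nonempty y A)) = y := by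
    have : ∀ᶠ y in 𝓝 p, f (hull (insert y A) (insert_nonempty y A)) ∈ Aᶜ := by
      refine (hf.2.comp (continuous_hull_insert A)).continuousAt.eventually_mem
        (hA.isClosed.isOpen_compl.mem_nhds ?_)
      rw [Function.comp_apply, hfp _ (subset_closure (mem_insert _ _))]
      exact hpA
    filter_upwards [this] with y hy
    have hm : f (hull (insert y A) (insert_nonempty y A)) ∈ closure (insert y A) :=
      hf.1 (hull (insert y A) (insert_nonempty y A))
    rw [closure_insert_eq, hA.isClosed.closure_eq] at hm
    exact hm.resolve_right hy
  have h₂ : ∀ᶠ y in 𝓝 p, ∀ z ∈ A, f (pair z y) = y ∧ z ≠ y := by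
    refine hA.eventually_forall_of_forall_eventually fun z hz => ?_
    have hzp : z ≠ p := fun h => hpA (h ▸ hz)
    have hs : Tendsto Prod.swap (𝓝 (p, z)) (𝓝 (z, p)) := continuous_swap.tendsto (p, z)
    exact hs.eventually (Sel.eventually_pair_eq_snd hf (hfp _ (by simp [pair])) hzp)
  have : (𝓝[≠] p).NeBot := ⟨fun h => hp ((isOpen_singleton_iff_punctured_nhds p).2 h)⟩
  have h₃ : ∀ᶠ y in 𝓝[≠] p, y ≠ p := self_mem_nhdsWithin
  obtain ⟨y, hy₁, hy₂, hy₃⟩ := ((h₁.filter_mono nhdsWithin_le_nhds).and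
    ((h₂.filter_mono nhdsWithin_le_nhds).and h₃)).exists
  exact ⟨y, hy₃, hy₁, hy₂⟩

theorem exists_isTower {p : X} (hf : IsMaximalAt f p) (hp : ¬ IsOpen ({p} : Set X)) :
    ∃ x lam, IsTower f x lam ∧ x lam = p := by
  classical
  obtain ⟨x, hx⟩ := exists_transfinite_rec fun (α : Ordinal.{u}) (A : Set X) =>
    if h : Order.IsSuccLimit α ∧ A.Nonempty then f (hull A h.2)
    else if h : ∃ y, y ≠ p ∧ IsNext f A y then h.choose else p
  have hnext : ∀ α, ¬ Order.IsSuccLimit α → (∀ β < α, x β ≠ p ∧ ContinuousAt x β) →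
      x α ≠ p ∧ IsNext f (x '' Iio α) (x α) := by
    intro α hα h
    -- Below a non-limit index the segment is empty or a closed interval.
    have hK : IsCompact (Iio α) := by
      rcases Ordinal.zero_or_succ_or_isSuccLimit α with rfl | ⟨β, rfl⟩ | hl
      · have : Iio (0 : Ordinal.{u}) = ∅ := by ext; simp
        rw [this]; exact isCompact_empty
      · rw [Order.Iio_succ, ← Icc_bot]; exact isCompact_Icc
      · exact absurd hl hα
    have hA : IsCompact (x '' Iio α) :=
      hK.image_of_continuousOn fun β hβ => (h β hβ).2.continuousWithinAt
    have hE := exists_isNext hf hp hA (by rintro ⟨β, hβ, h'⟩; exact (h β hβ).1 h')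
    rw [hx α, dif_neg fun h => hα h.1, dif_pos hE]
    exact hE.choose_spec
  have hlim : ∀ α (hα : Order.IsSuccLimit α) (hne : (Iio α).Nonempty),
      x α = f (hull (x '' Iio α) (hne.image x)) := by
    intro α hα hne
    rw [hx α, dif_pos ⟨hα, hne.image x⟩]
  have main : ∀ α, (∀ β < α, x β ≠ p) → f (hull (x '' Iic α) (nonempty_Iic.image x)) = x α ∧
      ContinuousAt x α ∧ ∀ β < α, f (pair (x β) (x α)) = x α ∧ x β ≠ x α := by
    intro α
    induction α using WellFoundedLT.induction with
    | ind α ih =>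
    intro hα
    have ih' : ∀ β < α, f (hull (x '' Iic β) (nonempty_Iic.image x)) = x β ∧
      ContinuousAt x β ∧ ∀ δ < β, f (pair (x δ) (x β)) = x β ∧ x δ ≠ x β :=
      fun β hβ => ih β hβ fun δ hδ => hα δ (hδ.trans hβ)
    have hins : x '' Iic α = insert (x α) (x '' Iio α) := by rw [← Iio_insert, image_insert_eq]
    by_cases hl : Order.IsSuccLimit α
    · have : (𝓝[<] α).NeBot := neBot_nhdsLT_of_isSuccLimit hl
      obtain ⟨a, ha⟩ := not_isMin_iff.1 hl.not_isMin
      have hne : (Iio α).Nonempty := ⟨a, ha⟩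
      have hxα := hlim α hl hne
      have ht : Tendsto x (𝓝[<] α) (𝓝 (x α)) := by
        rw [hxα]
        refine ((hf.1.2.tendsto _).comp (tendsto_hull_image_Iic x hne)).congr' ?_
        filter_upwards [self_mem_nhdsWithin] with β hβ
        exact (ih' β hβ).1
      have hle : ∀ β < α, f (pair (x β) (x α)) = x α := by
        intro β hβ
        have h₁ : Tendsto (fun δ => f (pair (x β) (x δ))) (𝓝[<] α) (𝓝 (f (pair (x β) (x α)))) :=
          (((Sel.continuous_pair hf.1).comp (Continuous.prodMk_right (x β))).tendsto _).comp ht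
        refine tendsto_nhds_unique (h₁.congr' ?_) ht
        filter_upwards [Ioo_mem_nhdsLT hβ] with δ hδ
        exact ((ih' δ hδ.2).2.2 β hδ.1).1
      refine ⟨?_, tendsto_nhds_of_tendsto_nhdsLT ht, fun β hβ => ⟨hle β hβ, fun h => ?_⟩⟩
      · conv_rhs => rw [hxα]
        congr 1
        refine Hyperspace.ext ?_
        have : x α ∈ closure (x '' Iio α) := by
          rw [hxα]; exact hf.1.1 (hull (x '' Iio α) (hne.image x))
        simp only [hull]
        rw [hins, closure_insert_eq, insert_eq_of_mem this]
      -- If `x β = x α`, then `x (succ β)` would lie both strictly below and above `x β`.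
      · have h₁ := hle _ (hl.succ_lt hβ)
        have h₂ := (ih' _ (hl.succ_lt hβ)).2.2 β (Order.lt_succ β)
        rw [← h, pair_comm, h₂.1] at h₁
        exact h₂.2 h₁.symm
    · obtain ⟨-, hn₁, hn₂⟩ := hnext α hl fun β hβ => ⟨hα β hβ, (ih' β hβ).2.1⟩
      refine ⟨?_, ?_, fun β hβ => hn₂ _ ⟨β, hβ, rfl⟩⟩
      · rwa [hull_congr hins]
      · rw [ContinuousAt, SuccOrder.nhds_eq_pure.2 hl]
        exact tendsto_pure_nhds x α
  have hex : ∃ α, x α = p := by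
    by_contra! hne
    -- A sequence avoiding `p` would inject all ordinals into X.
    refine not_injective_of_ordinal x fun α β h => ?_
    rcases lt_trichotomy α β with hlt | rfl | hlt
    · exact absurd h ((main β fun δ _ => hne δ).2.2 α hlt).2
    · rfl
    · exact absurd h.symm ((main α fun δ _ => hne δ).2.2 β hlt).2
  obtain ⟨lam, hlam, hmin⟩ : ∃ lam, x lam = p ∧ ∀ β < lam, x β ≠ p :=
    ⟨_, (wellFounded_lt (α := Ordinal.{u})).min_mem {α | x α = p} hex,
      fun β hβ h => (wellFounded_lt (α := Ordinal.{u})).not_lt_min {α | x α = p} h hβ⟩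
  have main' : ∀ γ ≤ lam, _ := fun γ hγ => main γ fun β hβ => hmin β (hβ.trans_le hγ)
  refine ⟨x, lam, ⟨?_, fun γ hγ => (main' γ hγ).2.1,
    fun β γ hβ hγ => (main' γ hγ).2.2 β hβ⟩, hlam⟩
  -- Non-limit stages choose points other than `p`.
  by_contra hl
  exact (hnext lam hl fun β hβ => ⟨hmin β hβ, (main' β hβ.le).2.1⟩).1 hlam

/-- The points which lie `f`-above the part of a tower starting at the index `α`. -/
def outer (f : Hyperspace X → X) (x : Ordinal.{u} → X) (lam α : Ordinal.{u}) : Set X :=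
  {r | ∀ β, α ≤ β → β ≤ lam → f (pair (x β) r) = x β}

theorem outer_mono (f : Hyperspace X → X) (x : Ordinal.{u} → X) (lam : Ordinal.{u})
    {α β : Ordinal.{u}} (h : α ≤ β) : outer f x lam α ⊆ outer f x lam β :=
  fun _ hr γ hγ => hr γ (h.trans hγ)

theorem isClosed_outer (hf : f ∈ Sel X) (x : Ordinal.{u} → X) (lam α : Ordinal.{u}) :
    IsClosed (outer f x lam α) := by
  simp only [outer, ofPred_forall]
  exact isClosed_iInter fun β => isClosed_iInter fun _ => isClosed_iInter fun _ =>
    isClosed_eq ((Sel.continuous_pair hf).comp (Continuous.prodMk_right _)) continuous_const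

/-! ### Points above a tail of a tower -/

namespace IsTower

variable {x : Ordinal.{u} → X} {lam α β : Ordinal.{u}}

theorem mem_outer (h : IsTower f x lam) (hf : f ∈ Sel X) (α : Ordinal.{u}) :
    x α ∈ outer f x lam α := by
  intro β hαβ hβ
  rcases hαβ.eq_or_lt with rfl | hlt
  · rcases Sel.pair_eq_or hf (x α) (x α) with h | h <;> exact h
  · rw [pair_comm]
    exact (h.pair_eq α β hlt hβ).1

theorem notMem_outer (h : IsTower f x lam) (hαβ : α < β) (hβ : β ≤ lam) :
    x β ∉ outer f x lam α := fun hm =>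
  (h.pair_eq α β hαβ hβ).2 ((hm α le_rfl (hαβ.le.trans hβ)).symm.trans (h.pair_eq α β hαβ hβ).1)

/-- Removing `x α` leaves the points strictly above every member of the compact tail, an open
condition. -/
theorem isOpen_outer_diff (h : IsTower f x lam) (hf : f ∈ Sel X) (hα : α ≤ lam) :
    IsOpen (outer f x lam α \ {x α}) := by
  have hK : IsCompact (x '' Icc α lam) :=
    isCompact_Icc.image_of_continuousOn fun β hβ => (h.continuousAt β hβ.2).continuousWithinAt
  have heq : outer f x lam α \ {x α} = {r | ∀ z ∈ x '' Icc α lam, f (pair z r) = z ∧ z ≠ r} := by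
    ext r
    constructor
    · rintro ⟨hr, hne⟩ _ ⟨β, hβ, rfl⟩
      refine ⟨hr β hβ.1 hβ.2, ?_⟩
      rintro rfl
      rcases hβ.1.eq_or_lt with rfl | hlt
      · exact hne rfl
      · exact h.notMem_outer hlt hβ.2 hr
    · intro hr
      exact ⟨fun β h₁ h₂ => (hr _ ⟨β, ⟨h₁, h₂⟩, rfl⟩).1,
        fun h => (hr _ ⟨α, ⟨le_rfl, hα⟩, rfl⟩).2 h.symm⟩
  rw [heq]
  refine isOpen_iff_eventually.2 fun r hr => ?_
  refine hK.eventually_forall_of_forall_eventually fun z hz => ?_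
  have hs : Tendsto Prod.swap (𝓝 (r, z)) (𝓝 (z, r)) := continuous_swap.tendsto (r, z)
  exact hs.eventually (Sel.eventually_pair_eq_fst hf (hr z hz).1 (hr z hz).2)

/-- Being strictly above `x γ` passes to `x β` for `β` slightly below `γ`, by continuity of the
tower. -/
theorem exists_lt_mem_outer (h : IsTower f x lam) (hf : f ∈ Sel X) {γ : Ordinal.{u}}
    (hγ : Order.IsSuccLimit γ) (hγl : γ ≤ lam) {r : X} (hr : r ∈ outer f x lam γ)
    (hne : r ≠ x γ) : ∃ α < γ, r ∈ outer f x lam α := by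
  have hev : ∀ᶠ β in 𝓝[<] γ, f (pair (x β) r) = x β := by
    have hc : Tendsto (fun β => (x β, r)) (𝓝 γ) (𝓝 (x γ, r)) :=
      ((Continuous.prodMk_left r).tendsto (x γ)).comp (h.continuousAt γ hγl)
    filter_upwards [(hc.eventually (Sel.eventually_pair_eq_fst hf (hr γ le_rfl hγl)
      hne.symm)).filter_mono nhdsWithin_le_nhds] with β hβ
    exact hβ.1
  obtain ⟨a, ha⟩ := not_isMin_iff.1 hγ.not_isMin
  obtain ⟨δ, hδ, hsub⟩ := (mem_nhdsLT_iff_exists_Ioo_subset' ha).1 hev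
  refine ⟨Order.succ δ, hγ.succ_lt hδ, fun β h₁ h₂ => ?_⟩
  rcases lt_or_ge β γ with hβ | hβ
  · exact hsub ⟨Order.succ_le_iff.1 h₁, hβ⟩
  · exact hr β hβ h₂

end IsTower

end

/-! ### Gluing selections over clopen layers -/

section

variable {X : Type u} [TopologicalSpace X] [T2Space X] {f : Hyperspace X → X}

/-- Openness of `outer α` can fail only at `x α`; adding a clopen neighbourhood of that point
repairs it. -/
theorem IsTower.exists_isClopen_between {x : Ordinal.{u} → X} {lam α : Ordinal.{u}}
    (h : IsTower f x lam) (hX : SelectionPointwiseMaximal X) (hf : f ∈ Sel X) (hα : α < lam) :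
    ∃ E : Set X, IsClopen E ∧ outer f x lam α ⊆ E ∧ E ⊆ outer f x lam (Order.succ α) := by
  have hs : Order.succ α ≤ lam := Order.succ_le_of_lt hα
  have hmem : x α ∈ outer f x lam (Order.succ α) \ {x (Order.succ α)} :=
    ⟨outer_mono f x lam (Order.le_succ α) (h.mem_outer hf α),
      (h.pair_eq α _ (Order.lt_succ α) hs).2⟩
  obtain ⟨G, hG, hxG, hGs⟩ := exists_isClopen_subset hX (h.isOpen_outer_diff hf hs) hmem
  refine ⟨outer f x lam α ∪ G, ⟨(isClosed_outer hf x lam α).union hG.1, ?_⟩, subset_union_left,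
    union_subset (outer_mono f x lam (Order.le_succ α)) (hGs.trans sdiff_subset)⟩
  have : outer f x lam α ∪ G = outer f x lam α \ {x α} ∪ G := by
    ext r
    by_cases hr : r = x α
    · simp [hr, hxG]
    · simp [hr]
  rw [this]
  exact (h.isOpen_outer_diff hf hα.le).union hG.2

theorem exists_isMinimalAt_of_not_isOpen_singleton (hX : SelectionPointwiseMaximal X) {p : X}
    (hp : ¬ IsOpen ({p} : Set X)) : ∃ g : Hyperspace X → X, IsMinimalAt g p := by
  classical
  obtain ⟨f, hfp⟩ := hX p
  obtain ⟨x, lam, hT, hxp⟩ := exists_isTower hfp hp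
  obtain ⟨hf, hfp⟩ := hfp
  have hE : ∀ α, ∃ E : Set X, IsClopen E ∧ (α < lam →
      outer f x lam α ⊆ E ∧ E ⊆ outer f x lam (Order.succ α)) := by
    intro α
    by_cases hα : α < lam
    · obtain ⟨E, hE, h⟩ := hT.exists_isClopen_between hX hf hα
      exact ⟨E, hE, fun _ => h⟩
    · exact ⟨∅, isClopen_empty, fun h => absurd h hα⟩
  choose E hEc hEo using hE
  choose sel hsel hmax using fun α => hX (x α)
  have hEout : ∀ β γ, β < γ → γ ≤ lam → E β ⊆ outer f x lam γ := fun β γ hβ hγ =>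
    (hEo β (hβ.trans_le hγ)).2.trans (outer_mono f x lam (Order.succ_le_of_lt hβ))
  have hpE : ∀ α < lam, p ∉ E α := fun α hα h =>
    hT.notMem_outer (hT.isSuccLimit.succ_lt hα) le_rfl (hxp ▸ (hEo α hα).2 h)
  have hcover : ∀ r, r ≠ p → ∃ α < lam, r ∈ E α := by
    intro r hr
    have hm : r ∈ outer f x lam lam := fun β h₁ h₂ => by
      rw [le_antisymm h₂ h₁, hxp]
      exact hfp _ (by simp [pair])
    obtain ⟨α, hα, h⟩ := hT.exists_lt_mem_outer hf hT.isSuccLimit le_rfl hm (hxp ▸ hr)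
    exact ⟨α, hα, (hEo α hα).1 h⟩
  set I : Hyperspace X → Set Ordinal.{u} := fun S =>
    {α | α < lam ∧ (S.carrier ∩ E α).Nonempty}
  have hInon : ∀ S : Hyperspace X, S.carrier ≠ {p} → (I S).Nonempty := by
    intro S hS
    obtain ⟨r, hrS, hr⟩ : ∃ r ∈ S.carrier, r ≠ p := by
      by_contra! h
      exact hS (S.nonempty.subset_singleton_iff.1 h)
    obtain ⟨α, hα, h⟩ := hcover r hr
    exact ⟨α, hα, r, hrS, h⟩
  set g : Hyperspace X → X := fun S =>
    if S.carrier = {p} then p else sel (sInf (I S)) (trace (E (sInf (I S))) (hEc _).1 S) with hg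
  have hgmem : ∀ S : Hyperspace X, S.carrier ≠ {p} → g S ∈ S.carrier ∩ E (sInf (I S)) := by
    intro S hS
    have h := csInf_mem (hInon S hS)
    have := (hsel (sInf (I S))).1 (trace (E (sInf (I S))) (hEc _).1 S)
    rw [trace_carrier _ h.2] at this
    simpa only [hg, if_neg hS] using this
  have hgS : ∀ S : Hyperspace X, g S ∈ S.carrier := by
    intro S
    by_cases hS : S.carrier = {p}
    · simp [hg, hS]
    · exact (hgmem S hS).1
  have hne : ∀ α < lam, ∀ T : Hyperspace X, (T.carrier ∩ E α).Nonempty → T.carrier ≠ {p} := by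
    rintro α hα T ⟨r, hr, hrE⟩ h
    rw [h] at hr
    exact hpE α hα (hr ▸ hrE)
  have hgeq : ∀ α < lam, ∀ T : Hyperspace X, (T.carrier ∩ E α).Nonempty →
      (∀ β < α, ¬ (T.carrier ∩ E β).Nonempty) → g T = sel α (trace (E α) (hEc α).1 T) := by
    intro α hα T hTα hTβ
    have : sInf (I T) = α := by
      refine le_antisymm (csInf_le' ⟨hα, hTα⟩) (le_of_not_gt fun hlt => ?_)
      exact hTβ _ hlt (csInf_mem ⟨α, hα, hTα⟩ : sInf (I T) ∈ I T).2
    simp only [hg, if_neg (hne α hα T hTα), this]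
  refine ⟨g, ⟨hgS, continuous_iff_continuousAt.2 fun S => ?_⟩, fun S hS hgp => ?_⟩
  swap
  · exact hpE _ (csInf_mem (hInon S hS)).1 (hgp ▸ (hgmem S hS).2)
  by_cases hS : S.carrier = {p}
  · have hgSp : g S = p := by simp [hg, hS]
    rw [ContinuousAt, hgSp, tendsto_nhds]
    intro V hV hpV
    filter_upwards [eventually_subset hV (S := S) (by rw [hS]; exact singleton_subset_iff.2 hpV)]
      with T hTV
    exact hTV (hgS T)
  obtain ⟨α, hα, hSα, hmin⟩ : ∃ α < lam, (S.carrier ∩ E α).Nonempty ∧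
      ∀ β < α, ¬ (S.carrier ∩ E β).Nonempty := by
    have h := csInf_mem (hInon S hS)
    exact ⟨_, h.1, h.2, fun β hβ hm => notMem_of_lt_csInf' hβ ⟨hβ.trans h.1, hm⟩⟩
  have htr : ContinuousAt (fun T => sel α (trace (E α) (hEc α).1 T)) S :=
    (hsel α).2.continuousAt.comp (continuousAt_trace (hEc α) hSα)
  have hmeets := eventually_meets (hEc α).2 hSα
  -- When a closed set missing S contains all earlier layers, sets near S keep the least index `α`,
  -- so `g` is locally `sel α` of the trace.
  have key : ∀ F : Set X, IsClosed F → (∀ β < α, E β ⊆ F) → S.carrier ⊆ Fᶜ →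
      ContinuousAt g S := by
    intro F hF hEF hSF
    refine htr.congr ?_
    filter_upwards [hmeets, eventually_subset hF.isOpen_compl hSF] with T hTα hTF
    refine (hgeq α hα T hTα fun β hβ => ?_).symm
    rintro ⟨r, hrT, hrE⟩
    exact hTF hrT (hEF β hβ hrE)
  rcases Ordinal.zero_or_succ_or_isSuccLimit α with h0 | ⟨β, hβ⟩ | hl
  · exact key ∅ isClosed_empty (fun β hβ => by simp [h0] at hβ) (by simp)
  · have hβα : β < α := hβ ▸ Order.lt_succ β
    refine key (E β) (hEc β).1 (fun δ hδ => ?_) fun r hr hrE => hmin β hβα ⟨r, hr, hrE⟩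
    rw [← hβ, Order.lt_succ_iff] at hδ
    rcases hδ.eq_or_lt with rfl | hδ
    · exact Subset.rfl
    · exact (hEout δ β hδ (hβα.trans hα).le).trans (hEo β (hβα.trans hα)).1
  -- At a limit, a set missing all earlier layers meets `outer α` at most in `x α`.
  · have hSout : ∀ r ∈ S.carrier, r ∈ outer f x lam α → r = x α := by
      intro r hr hro
      by_contra hrx
      obtain ⟨δ, hδ, h⟩ := hT.exists_lt_mem_outer hf hl hα.le hro hrx
      exact hmin δ hδ ⟨r, hr, (hEo δ (hδ.trans hα)).1 h⟩
    by_cases hxS : x α ∈ S.carrier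
    swap
    · exact key _ (isClosed_outer hf x lam α) (fun β hβ => hEout β α hβ hα.le)
        fun r hr hro => hxS (hSout r hr hro ▸ hr)
    have hxα : sel α (trace (E α) (hEc α).1 S) = x α := by
      refine hmax α _ ?_
      rw [trace_carrier _ hSα]
      exact ⟨hxS, (hEo α hα).1 (hT.mem_outer hf α)⟩
    rw [ContinuousAt, hgeq α hα S hSα hmin, hxα, tendsto_nhds]
    intro V hV hxV
    have hsub : S.carrier ⊆ V ∪ (outer f x lam α)ᶜ := fun r hr => by
      by_cases hro : r ∈ outer f x lam α
      · exact Or.inl (hSout r hr hro ▸ hxV)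
      · exact Or.inr hro
    filter_upwards [hmeets,
      eventually_subset (hV.union (isClosed_outer hf x lam α).isOpen_compl) hsub,
      htr.eventually_mem (hV.mem_nhds (hxα.symm ▸ hxV))] with T hTα hTV hTsel
    -- If the least index of T drops below `α`, then `g T` lies in `T ∩ outer α`, hence still in
    -- `V`.
    by_cases hlow : ∀ β < α, ¬ (T.carrier ∩ E β).Nonempty
    · rw [mem_preimage, hgeq α hα T hTα hlow]
      exact hTsel
    · push Not at hlow
      obtain ⟨β, hβ, hTβ⟩ := hlow
      have hlt : sInf (I T) < α := (csInf_le' (s := I T) ⟨hβ.trans hα, hTβ⟩).trans_lt hβ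
      have hm := hgmem T (hne α hα T hTα)
      exact (hTV hm.1).resolve_right fun h => h (hEout _ α hlt hα.le hm.2)

end

end HyperspaceSelection

theorem theorem6p5 (X : Type u) [TopologicalSpace X] [T2Space X]
    (hX : HyperspaceSelection.SelectionPointwiseMaximal X) :
    HyperspaceSelection.SelectionPointwiseMinimal X := by
  intro p
  by_cases hp : IsOpen ({p} : Set X)
  · obtain ⟨f, hf, -⟩ := hX p
    exact HyperspaceSelection.exists_isMinimalAt_of_isOpen_singleton hf hp
  · exact HyperspaceSelection.exists_isMinimalAt_of_not_isOpen_singleton hX hp
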